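/- Let $\mathbb{F}$ be a division ring, $\sigma:\mathbb{F}\to\mathbb{F}$ a ring endomorphism and $\delta:\mathbb{F}\to\mathbb{F}$ a $\sigma$-derivation (that is, $\delta$ is additive and $\delta(ab)=\sigma(a)\delta(b)+\delta(a)b$). Let $\mathbb{F}[x;\sigma,\delta]$ be the skew polynomial ring, with elements $\sum_i F_i x^i$ and product determined by $xa=\sigma(a)x+\delta(a)$. Definitions. An element $a\in\mathbb{F}$ is a zero of $F\in\mathbb{F}[x;\sigma,\delta]$ if $x-a$ divides $F$ on the right. For $\mathbf{a}=(a_1,\dots,a_r)\in\mathbb{F}^r$, $r\ge 1$, put $P_{\mathbf{a}}=(x-a_r)\cdots(x-a_2)(x-a_1)$; $\mathbf{a}$ is a multiplicity sequence starting at $a_1$ if $a_1$ is the only zero of $P_{\mathbf{a}}$. An element $a$ is a zero of $F$ of multiplicity $r$ via a multiplicity sequence $\mathbf{a}\in\mathbb{F}^r$ starting at $a$ if $P_{\mathbf{a}}$ divides $F$ on the right, and it is a zero of $F$ of multiplicity $r$ if this holds for some such $\mathbf{a}$. For a set $\Omega$ of skew polynomials of degree at least $1$ that has a non-zero common left multiple,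 $F_\Omega$ denotes the unique monic skew polynomial of least degree among the non-zero skew polynomials divisible on the right by every element of $\Omega$. A finite set $\{a_1,\dots,a_n\}\subseteq\mathbb{F}$ of size $n$ is P-independent if $\deg F_{\{x-a_1,\dots,x-a_n\}}=n$. Theorem (Degree bound II). Let $n\ge 1$, let $\Psi=\{a_1,\dots,a_n\}\subseteq\mathbb{F}$ be a set of size $n$ and let $r_1,\dots,r_n\ge 1$ be integers. Consider the degree bound: for every non-zero $F\in\mathbb{F}[x;\sigma,\delta]$ that has $a_i$ as a zero of multiplicity $r_i$, for $i=1,\dots,n$, it holds that $$\sum_{i=1}^n r_i\le\deg(F).\qquad(*)$$ 1. If $\Psi$ is P-independent, then the degree bound holds. 2. Conversely, assume that for every $i$ there is at least one multiplicity sequence in $\mathbb{F}^{r_i}$ starting at $a_i$. If the degree bound holds, then $\Psi$ is P-independent. 3. Let $\Psi$ be P-independent, and let $F$ be a non-zero skew polynomial that has $a_i$ as a zero of multiplicity $r_i$ for $i=1,\dots,n$. Then equality holds in $(*)$ if and only if there are $c\in\mathbb{F}^*$ and multiplicity sequences $\mathbf{a}_i\in\mathbb{F}^{r_i}$ starting at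 $a_i$, $i=1,\dots,n$, such that $F=c\,F_\Omega$ with $\Omega=\{P_{\mathbf{a}_1},\dots,P_{\mathbf{a}_n}\}$. Moreover, for any prescribed multiplicity sequences $\mathbf{a}_i\in\mathbb{F}^{r_i}$ via which $F$ has the zeros $a_i$ of multiplicity $r_i$, equality holds in $(*)$ if and only if $F=c\,F_\Omega$ for some $c\in\mathbb{F}^*$, with this $\Omega$. 4. For all multiplicity sequences $\mathbf{a}_i\in\mathbb{F}^{r_i}$ starting at $a_i$, $i=1,\dots,n$, and $\Omega=\{P_{\mathbf{a}_1},\dots,P_{\mathbf{a}_n}\}$, the skew polynomial $F_\Omega$ is the least left common multiple of $P_{\mathbf{a}_1},\dots,P_{\mathbf{a}_n}$: it is monic, every $P_{\mathbf{a}_i}$ divides it on the right, and it divides on the right every skew polynomial that is divisible on the right by all $P_{\mathbf{a}_i}$. -/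

import Mathlib

/-- A `σ`-derivation of a division ring: an additive map `δ` with
`δ (a * b) = σ a * δ b + δ a * b`. -/
structure SigmaDerivation {K : Type*} [DivisionRing K] (σ : K →+* K) extends K →+ K where
  leibniz' : ∀ a b : K, toFun (a * b) = σ a * toFun b + toFun a * b

/-- The skew polynomial ring `K[x; σ, δ]`: as a left `K`-vector space it has the basis
`1, x, x², …`, and a polynomial is its family of (left) coefficients. -/
def SkewPoly {K : Type*} [DivisionRing K] (σ : K →+* K) (_δ : SigmaDerivation σ) : Type _ :=
  ℕ →₀ K

namespace SkewPoly

variable {K : Type*} [DivisionRing K] {σ : K →+* K} {δ : SigmaDerivation σ}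

noncomputable instance instAddCommGroup : AddCommGroup (SkewPoly σ δ) :=
  inferInstanceAs (AddCommGroup (ℕ →₀ K))

noncomputable instance instModule : Module K (SkewPoly σ δ) :=
  inferInstanceAs (Module K (ℕ →₀ K))

/-- The skew polynomial `a xⁱ`. -/
noncomputable def monomial (i : ℕ) : K →+ SkewPoly σ δ :=
  (Finsupp.singleAddHom i : K →+ (ℕ →₀ K))

/-- The coefficient of `xⁱ`. -/
def coeff (F : SkewPoly σ δ) (i : ℕ) : K := (show ℕ →₀ K from F) i

/-- Extend additively from monomials. -/
noncomputable def lift {M : Type*} [AddCommGroup M] (f : ℕ → K →+ M) : SkewPoly σ δ →+ M :=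
  (Finsupp.liftAddHom f : (ℕ →₀ K) →+ M)

theorem lift_monomial {M : Type*} [AddCommGroup M] (f : ℕ → K →+ M) (i : ℕ) (a : K) :
    lift f (monomial i a : SkewPoly σ δ) = f i a :=
  Finsupp.liftAddHom_apply_single f i a

theorem smul_monomial (b : K) (i : ℕ) (a : K) :
    b • (monomial i a : SkewPoly σ δ) = monomial i (b * a) :=
  Finsupp.smul_single b i a

/-- Left multiplication by `x`: the additive map with
`a xⁱ ↦ σ(a) xⁱ⁺¹ + δ(a) xⁱ`. -/
noncomputable def mulX : AddMonoid.End (SkewPoly σ δ) :=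
  lift fun i => (monomial (i + 1)).comp σ.toAddMonoidHom + (monomial i).comp δ.toAddMonoidHom

theorem mulX_monomial (i : ℕ) (a : K) :
    mulX (monomial i a : SkewPoly σ δ) = monomial (i + 1) (σ a) + monomial i (δ.toFun a) :=
  lift_monomial _ i a

/-- Left multiplication: `(∑ aᵢ xⁱ) * G = ∑ aᵢ • (x (x (⋯ (x G))))`, with `i` factors `x`. -/
noncomputable def lmul : SkewPoly σ δ →+ AddMonoid.End (SkewPoly σ δ) :=
  lift fun i => (AddMonoidHom.mulRight (mulX ^ i)).comp
    (Module.toAddMonoidEnd K (SkewPoly σ δ)).toAddMonoidHom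

theorem lmul_monomial (i : ℕ) (a : K) (G : SkewPoly σ δ) :
    lmul (monomial i a) G = a • (mulX ^ i : AddMonoid.End (SkewPoly σ δ)) G :=
  DFunLike.congr_fun (lift_monomial (σ := σ) (δ := δ) _ i a) G

theorem additive_induction {p : SkewPoly σ δ → Prop} (F : SkewPoly σ δ) (h0 : p 0)
    (hadd : ∀ F G, p F → p G → p (F + G)) (h : ∀ i a, p (monomial i a)) : p F :=
  Finsupp.induction_linear (M := K) F h0 hadd h

theorem lmul_add_apply (F F' G : SkewPoly σ δ) : lmul (F + F') G = lmul F G + lmul F' G := by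
  rw [map_add]; rfl

theorem lmul_zero_apply (G : SkewPoly σ δ) : lmul 0 G = 0 := by
  rw [map_zero]; rfl

theorem mulX_smul (b : K) (G : SkewPoly σ δ) :
    mulX (b • G) = σ b • mulX G + δ.toFun b • G := by
  induction G using additive_induction with
  | h0 => simp only [smul_zero, map_zero, add_zero]
  | hadd F G hF hG => simp only [smul_add, map_add, hF, hG]; abel
  | h i a =>
    simp only [smul_monomial, mulX_monomial, smul_add]
    rw [δ.leibniz', map_mul, map_add]
    abel

theorem lmul_smul (b : K) (F G : SkewPoly σ δ) : lmul (b • F) G = b • lmul F G := by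
  induction F using additive_induction with
  | h0 => simp only [smul_zero, lmul_zero_apply]
  | hadd F F' hF hF' => simp only [smul_add, lmul_add_apply, hF, hF']
  | h i a => simp only [smul_monomial, lmul_monomial, mul_smul]

theorem lmul_mulX (F G : SkewPoly σ δ) : lmul (mulX F) G = mulX (lmul F G) := by
  induction F using additive_induction with
  | h0 => rw [map_zero, lmul_zero_apply, map_zero]
  | hadd F F' hF hF' => rw [map_add, lmul_add_apply, lmul_add_apply, map_add, hF, hF']
  | h i a =>
    simp only [mulX_monomial, lmul_add_apply, lmul_monomial, mulX_smul, pow_succ']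
    rfl

theorem lmul_mulX_pow (i : ℕ) (F G : SkewPoly σ δ) :
    lmul ((mulX ^ i : AddMonoid.End (SkewPoly σ δ)) F) G =
      (mulX ^ i : AddMonoid.End (SkewPoly σ δ)) (lmul F G) := by
  induction i with
  | zero => rfl
  | succ i ih =>
    rw [pow_succ']
    exact (lmul_mulX _ G).trans (congrArg mulX ih)

theorem lmul_assoc (F G H : SkewPoly σ δ) : lmul (lmul F G) H = lmul F (lmul G H) := by
  induction F using additive_induction with
  | h0 => simp only [lmul_zero_apply]
  | hadd F F' hF hF' => simp only [lmul_add_apply, hF, hF']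
  | h i a => simp only [lmul_monomial, lmul_smul, lmul_mulX_pow]

theorem mulX_pow_one (i : ℕ) :
    (mulX ^ i : AddMonoid.End (SkewPoly σ δ)) (monomial 0 1) = monomial i 1 := by
  have hδ : δ.toFun 1 = 0 := by simpa using δ.leibniz' 1 1
  induction i with
  | zero => rfl
  | succ i ih =>
    rw [pow_succ']
    refine (congrArg mulX ih).trans ?_
    rw [mulX_monomial, hδ, map_one, map_zero, add_zero]

theorem lmul_one (F : SkewPoly σ δ) : lmul F (monomial 0 1) = F := by
  induction F using additive_induction with
  | h0 => rw [lmul_zero_apply]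
  | hadd F F' hF hF' => rw [lmul_add_apply, hF, hF']
  | h i a => rw [lmul_monomial, mulX_pow_one, smul_monomial, mul_one]

theorem one_lmul (F : SkewPoly σ δ) : lmul (monomial 0 1) F = F := by
  rw [lmul_monomial, one_smul]; rfl

noncomputable instance instRing : Ring (SkewPoly σ δ) :=
  { instAddCommGroup with
    mul := fun F G => lmul F G
    one := monomial 0 1
    mul_assoc := lmul_assoc
    one_mul := one_lmul
    mul_one := lmul_one
    left_distrib := fun F G H => map_add (lmul F) G H
    right_distrib := fun F G H => by
      exact lmul_add_apply F G H
    zero_mul := fun F => by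
      exact lmul_zero_apply F
    mul_zero := fun F => map_zero (lmul F) }

/-- The constant polynomial `a`. -/
noncomputable def C (a : K) : SkewPoly σ δ := monomial 0 a

/-- The variable `x`. -/
noncomputable def X : SkewPoly σ δ := monomial 1 1

theorem C_mul (a : K) (F : SkewPoly σ δ) : C a * F = a • F :=
  lmul_monomial 0 a F

theorem C_mul_C (a b : K) : (C a * C b : SkewPoly σ δ) = C (a * b) := by
  rw [C_mul]; exact smul_monomial a 0 b

/-- The defining rule `x a = σ(a) x + δ(a)`. -/
theorem X_mul_C (a : K) : (X * C a : SkewPoly σ δ) = C (σ a) * X + C (δ.toFun a) := by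
  rw [C_mul]
  change lmul (monomial 1 1) (monomial 0 a) = σ a • monomial 1 1 + monomial 0 (δ.toFun a)
  rw [lmul_monomial, one_smul, pow_one, mulX_monomial, smul_monomial, mul_one]

theorem monomial_eq (i : ℕ) (a : K) : (monomial i a : SkewPoly σ δ) = C a * X ^ i := by
  induction i with
  | zero => rw [pow_zero, mul_one]; rfl
  | succ i ih =>
    rw [pow_succ, ← mul_assoc, ← ih]
    change _ = lmul (monomial i a) (monomial 1 1)
    rw [lmul_monomial, ← mulX_pow_one 1]
    change _ = a • ((mulX ^ i * mulX ^ 1 : AddMonoid.End (SkewPoly σ δ)) (monomial 0 1))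
    rw [← pow_add, mulX_pow_one, smul_monomial, mul_one]

/-- The degree, with `degree 0 = ⊥`. -/
def degree (F : SkewPoly σ δ) : WithBot ℕ := (show ℕ →₀ K from F).support.max

/-- The degree as a natural number, with the junk value `0` at `F = 0`. -/
def natDegree (F : SkewPoly σ δ) : ℕ := F.degree.unbotD 0

/-- The leading coefficient is `1`. -/
def Monic (F : SkewPoly σ δ) : Prop := F.coeff F.natDegree = 1

/-- `P` divides `F` on the right; for `deg P ≥ 1` this says that the remainder of the right
Euclidean division of `F` by `P` is zero, that is, `F(P) = 0`. -/
def RightDvd (P F : SkewPoly σ δ) : Prop := ∃ G : SkewPoly σ δ, F = G * P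

/-- `a` is a (right) zero of `F`: `x - a` divides `F` on the right. -/
def IsZeroOf (F : SkewPoly σ δ) (a : K) : Prop := RightDvd (X - C a) F

/-- The set `I(Ω)` of all skew polynomials that vanish at all `P ∈ Ω`. -/
def vanishingIdeal (Ω : Set (SkewPoly σ δ)) : Set (SkewPoly σ δ) :=
  {F | ∀ P ∈ Ω, RightDvd P F}

/-- `I(Ω) ≠ {0}`. -/
def IsAlgebraicSet (Ω : Set (SkewPoly σ δ)) : Prop := vanishingIdeal Ω ≠ {0}

/-- `M` is monic and has the least degree among the non-zero elements of `I(Ω)`. -/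
def IsMinimalFor (Ω : Set (SkewPoly σ δ)) (M : SkewPoly σ δ) : Prop :=
  M ∈ vanishingIdeal Ω ∧ M.Monic ∧ ∀ G ∈ vanishingIdeal Ω, G ≠ 0 → M.degree ≤ G.degree

open Classical in
/-- The minimal skew polynomial `F_Ω`; it is `0` if `Ω` is not algebraic. -/
noncomputable def minimalPoly (Ω : Set (SkewPoly σ δ)) : SkewPoly σ δ :=
  if h : ∃ M, IsMinimalFor Ω M then h.choose else 0

theorem coe_natDegree {F : SkewPoly σ δ} (hF : F ≠ 0) : (F.natDegree : WithBot ℕ) = F.degree := by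
  obtain ⟨n, hn⟩ := Finset.max_of_nonempty (Finsupp.support_nonempty_iff (f := F).2 hF)
  have h : F.degree = n := hn
  rw [natDegree, h]; rfl

theorem coeff_natDegree_ne_zero {F : SkewPoly σ δ} (hF : F ≠ 0) : F.coeff F.natDegree ≠ 0 :=
  Finsupp.mem_support_iff.1 (Finset.mem_of_max (coe_natDegree hF).symm)

theorem coeff_eq_zero_of_lt {F : SkewPoly σ δ} {i : ℕ} (h : F.degree < i) : F.coeff i = 0 := by
  by_contra hne
  exact absurd (Finset.le_max (Finsupp.mem_support_iff.2 hne)) (not_le.2 h)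

theorem degree_C_mul {c : K} (hc : c ≠ 0) (F : SkewPoly σ δ) : (C c * F).degree = F.degree := by
  rw [C_mul]
  exact congrArg Finset.max (Finsupp.support_smul_eq (M := K) (g := F) hc)

/-- An algebraic set has a minimal skew polynomial. -/
theorem exists_isMinimalFor {Ω : Set (SkewPoly σ δ)} (h : IsAlgebraicSet Ω) :
    ∃ M, IsMinimalFor Ω M := by
  have h0 : (0 : SkewPoly σ δ) ∈ vanishingIdeal Ω := fun P _ => ⟨0, (zero_mul P).symm⟩
  have hne : ∃ F ∈ vanishingIdeal Ω, F ≠ 0 := by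
    by_contra hcon
    push Not at hcon
    exact h (Set.eq_singleton_iff_unique_mem.2 ⟨h0, hcon⟩)
  obtain ⟨F, ⟨hF, hF0⟩, hmin⟩ := WellFounded.has_min
    (InvImage.wf (degree (σ := σ) (δ := δ)) wellFounded_lt)
    {F | F ∈ vanishingIdeal Ω ∧ F ≠ 0} hne
  have hc := coeff_natDegree_ne_zero hF0
  have hdeg := degree_C_mul (inv_ne_zero hc) F
  refine ⟨C (F.coeff F.natDegree)⁻¹ * F, fun P hP => ?_, ?_, fun G hG hG0 => ?_⟩
  · obtain ⟨G, hG⟩ := hF P hP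
    exact ⟨C (F.coeff F.natDegree)⁻¹ * G, by rw [mul_assoc, ← hG]⟩
  · have hn : (C (F.coeff F.natDegree)⁻¹ * F).natDegree = F.natDegree := by
      rw [natDegree, hdeg]; rfl
    rw [Monic, hn, C_mul]
    exact inv_mul_cancel₀ hc
  · rw [hdeg]; exact not_lt.1 (hmin G ⟨hG, hG0⟩)

/-- The minimal skew polynomial is unique. -/
theorem IsMinimalFor.unique {Ω : Set (SkewPoly σ δ)} {M N : SkewPoly σ δ}
    (hM : IsMinimalFor Ω M) (hN : IsMinimalFor Ω N) : M = N := by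
  have ne : ∀ {P : SkewPoly σ δ}, P.Monic → P ≠ 0 := by
    rintro P hP rfl
    exact zero_ne_one (α := K) hP
  have hd : M.degree = N.degree :=
    le_antisymm (hM.2.2 N hN.1 (ne hN.2.1)) (hN.2.2 M hM.1 (ne hM.2.1))
  have hnd : M.natDegree = N.natDegree := by rw [natDegree, hd]; rfl
  by_contra hne
  have hD : M - N ≠ 0 := sub_ne_zero.2 hne
  have hmem : M - N ∈ vanishingIdeal Ω := fun P hP => by
    obtain ⟨G, hG⟩ := hM.1 P hP
    obtain ⟨H, hH⟩ := hN.1 P hP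
    exact ⟨G - H, by rw [sub_mul, ← hG, ← hH]⟩
  have hle := hM.2.2 _ hmem hD
  have hcs : ∀ i, (M - N).coeff i = M.coeff i - N.coeff i := fun i =>
    Finsupp.sub_apply (G := K) M N i
  apply coeff_natDegree_ne_zero hD
  rw [hcs]
  rcases hle.lt_or_eq with hlt | heq
  · have h1 : M.degree < ((M - N).natDegree : WithBot ℕ) := by rwa [coe_natDegree hD]
    rw [coeff_eq_zero_of_lt h1, coeff_eq_zero_of_lt (hd ▸ h1), sub_zero]
  · have h1 : (M - N).natDegree = M.natDegree := by rw [natDegree, ← heq]; rfl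
    have h2 : M.coeff M.natDegree = 1 := hM.2.1
    have h3 : N.coeff N.natDegree = 1 := hN.2.1
    rw [h1, h2, hnd, h3, sub_self]

theorem minimalPoly_spec {Ω : Set (SkewPoly σ δ)} (h : IsAlgebraicSet Ω) :
    IsMinimalFor Ω (minimalPoly Ω) := by
  rw [minimalPoly, dif_pos (exists_isMinimalFor h)]
  exact (exists_isMinimalFor h).choose_spec

/-- P-independence of a set of skew polynomials of positive degree: it is finite and algebraic,
and `deg F_Ω` is the sum of the degrees of its elements. -/
def IsPIndependent (Ω : Set (SkewPoly σ δ)) : Prop :=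
  ∃ hfin : Ω.Finite, IsAlgebraicSet Ω ∧
    (minimalPoly Ω).degree = ((∑ P ∈ hfin.toFinset, P.natDegree : ℕ) : WithBot ℕ)

variable (δ) in
/-- P-independence of a set of elements of the division ring, through the set of all `x - a`. -/
def IsPIndependentPoints (Ψ : Set K) : Prop :=
  IsPIndependent ((fun a => (X - C a : SkewPoly σ δ)) '' Ψ)

variable (δ) in
/-- `P_𝐚 = (x - a_r) ⋯ (x - a_2) (x - a_1)` for the list `𝐚 = [a_1, a_2, …, a_r]`. -/
noncomputable def linProd : List K → SkewPoly σ δ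
  | [] => 1
  | a :: s => linProd s * (X - C a)

variable (δ) in
/-- The list `𝐚 = [a_1, …, a_r]` (with `r ≥ 1`) is a `(σ, δ)`-multiplicity sequence that starts
at `a_1 = a`: the element `a` is the only right zero of `P_𝐚`. -/
def IsMultSeqFrom (a : K) (s : List K) : Prop :=
  s.head? = some a ∧ ∀ b : K, IsZeroOf (linProd δ s) b ↔ b = a

/-- `a` is a zero of `F` of multiplicity `r`: `P_𝐚` divides `F` on the right for some
multiplicity sequence `𝐚` of length `r` that starts at `a`. -/
def IsZeroOfMultiplicity (F : SkewPoly σ δ) (a : K) (r : ℕ) : Prop :=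
  ∃ s : List K, IsMultSeqFrom δ a s ∧ s.length = r ∧ RightDvd (linProd δ s) F

/-- `M` is the (monic) least left common multiple of the family `P`. -/
def IsLLCM {ι : Type*} (P : ι → SkewPoly σ δ) (M : SkewPoly σ δ) : Prop :=
  M.Monic ∧ (∀ i, RightDvd (P i) M) ∧
    ∀ G : SkewPoly σ δ, (∀ i, RightDvd (P i) G) → RightDvd M G

end SkewPoly

/-! Write `R` for the skew polynomial ring. Right division by `P ≠ 0` shows that `R/RP` has left
dimension `deg P` over `K`. If `M` is the least left common multiple of `P_1, …, P_n`, then `R/RM`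
embeds into `∏ R/RP_i`. Hence `deg M ≤ ∑ deg P_i`, with equality exactly when `R → ∏ R/RP_i` is
surjective (`IsLLCM.natDegree_eq_iff`). For `P_i = x - a_i` this surjectivity is P-independence.

Surjectivity depends only on the maximal left ideals above each `RP_i`
(`Ideal.surjective_pi_mkQ_of_le_maximal`). A maximal left ideal containing a product of linear
factors contains some `x - b` (`exists_X_sub_C_mem_of_linProd_mem`), and then `b` is a zero of the
product. So for a multiplicity sequence starting at `a`, the only maximal left ideal above `P_𝐚` is
`R(x - a)`. Therefore `deg F_Ω = ∑ r_i` if and only if the points `a_i` are P-independent, and the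
theorem follows because `F_Ω` divides every common left multiple on the right. -/

namespace SkewPoly

variable {K : Type*} [DivisionRing K] {σ : K →+* K} {δ : SigmaDerivation σ}

/-! ### Coefficients and degrees -/

@[ext]
theorem ext_coeff {F G : SkewPoly σ δ} (h : ∀ i, F.coeff i = G.coeff i) : F = G :=
  Finsupp.ext (M := K) h

@[simp]
theorem coeff_zero (i : ℕ) : (0 : SkewPoly σ δ).coeff i = 0 := rfl

@[simp]
theorem coeff_add (F G : SkewPoly σ δ) (i : ℕ) : (F + G).coeff i = F.coeff i + G.coeff i :=
  Finsupp.add_apply (M := K) F G i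

@[simp]
theorem coeff_sub (F G : SkewPoly σ δ) (i : ℕ) : (F - G).coeff i = F.coeff i - G.coeff i :=
  Finsupp.sub_apply (G := K) F G i

@[simp]
theorem coeff_smul (c : K) (F : SkewPoly σ δ) (i : ℕ) : (c • F).coeff i = c * F.coeff i := rfl

theorem coeff_monomial (i : ℕ) (a : K) (j : ℕ) :
    (monomial i a : SkewPoly σ δ).coeff j = if i = j then a else 0 :=
  Finsupp.single_apply (M := K)

theorem degree_lt_iff {F : SkewPoly σ δ} {n : ℕ} :
    F.degree < n ↔ ∀ i, n ≤ i → F.coeff i = 0 := by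
  refine ⟨fun h i hi => coeff_eq_zero_of_lt (h.trans_le (by exact_mod_cast hi)), fun h => ?_⟩
  by_cases hF : F = 0
  · subst hF
    exact WithBot.bot_lt_coe n
  · rw [← coe_natDegree hF, Nat.cast_lt]
    by_contra hn
    exact coeff_natDegree_ne_zero hF (h _ (not_lt.1 hn))

theorem degree_eq_of_coeff {F : SkewPoly σ δ} {n : ℕ} (hn : F.coeff n ≠ 0)
    (h : ∀ i, n < i → F.coeff i = 0) : F.degree = n := by
  have hF : F ≠ 0 := by
    rintro rfl
    exact hn rfl
  refine le_antisymm ?_ (not_lt.1 fun hlt => hn (coeff_eq_zero_of_lt hlt))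
  rw [← coe_natDegree hF, Nat.cast_le]
  by_contra hlt
  exact coeff_natDegree_ne_zero hF (h _ (not_le.1 hlt))

theorem natDegree_of_degree {F : SkewPoly σ δ} {n : ℕ} (h : F.degree = n) : F.natDegree = n := by
  rw [natDegree, h]; rfl

theorem ne_zero_of_degree {F : SkewPoly σ δ} {n : ℕ} (h : F.degree = n) : F ≠ 0 := by
  rintro rfl
  exact WithBot.bot_ne_coe h

theorem coeff_eq_zero_of_natDegree_lt {F : SkewPoly σ δ} {i : ℕ} (h : F.natDegree < i) :
    F.coeff i = 0 := by
  by_cases hF : F = 0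
  · rw [hF, coeff_zero]
  · exact coeff_eq_zero_of_lt (by rw [← coe_natDegree hF]; exact_mod_cast h)

/-! ### Leading terms, degrees of products and right division -/

theorem coeff_mulX_succ (F : SkewPoly σ δ) (i : ℕ) :
    (mulX F).coeff (i + 1) = σ (F.coeff i) + δ.toFun (F.coeff (i + 1)) := by
  have h0 : δ.toFun 0 = 0 := δ.toAddMonoidHom.map_zero
  have hadd : ∀ a b, δ.toFun (a + b) = δ.toFun a + δ.toFun b := δ.toAddMonoidHom.map_add
  induction F using additive_induction with
  | h0 => simp [h0]
  | hadd F G hF hG => simp only [map_add, coeff_add, hF, hG, hadd]; abel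
  | h j a =>
    simp only [mulX_monomial, coeff_add, coeff_monomial, add_left_inj]
    split_ifs <;> simp [h0]

/-- The derivation `δ` does not raise the degree, so only `σ` reaches the top coefficient. -/
theorem coeff_mulX_pow (F : SkewPoly σ δ) {n : ℕ} (hF : ∀ i, n < i → F.coeff i = 0) (k : ℕ) :
    ((mulX ^ k : AddMonoid.End (SkewPoly σ δ)) F).coeff (k + n) = σ^[k] (F.coeff n) ∧
      ∀ i, k + n < i → ((mulX ^ k : AddMonoid.End (SkewPoly σ δ)) F).coeff i = 0 := by
  have h0 : δ.toFun 0 = 0 := δ.toAddMonoidHom.map_zero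
  induction k with
  | zero => exact ⟨by rw [zero_add]; rfl, fun i hi => hF i (by omega)⟩
  | succ k ih =>
    have hs : (mulX ^ (k + 1) : AddMonoid.End (SkewPoly σ δ)) F =
        mulX ((mulX ^ k : AddMonoid.End (SkewPoly σ δ)) F) := by rw [pow_succ']; rfl
    rw [hs]
    constructor
    · rw [show k + 1 + n = k + n + 1 by omega, coeff_mulX_succ, ih.1, ih.2 _ (by omega), h0,
        add_zero, Function.iterate_succ_apply']
    · rintro (_ | i) hi
      · omega
      · rw [coeff_mulX_succ, ih.2 i (by omega), ih.2 (i + 1) (by omega), h0, map_zero, add_zero]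

theorem monomial_mul (i : ℕ) (a : K) (G : SkewPoly σ δ) :
    monomial i a * G = a • (mulX ^ i : AddMonoid.End (SkewPoly σ δ)) G :=
  lmul_monomial i a G

theorem iterate_ne_zero {a : K} (ha : a ≠ 0) (k : ℕ) : σ^[k] a ≠ 0 := by
  induction k with
  | zero => exact ha
  | succ k ih => rw [Function.iterate_succ_apply']; exact (map_ne_zero σ).2 ih

theorem degree_sub_monomial_lt {F : SkewPoly σ δ} {n : ℕ} (h : F.degree < (n + 1 : ℕ)) :
    (F - monomial n (F.coeff n) : SkewPoly σ δ).degree < (n : WithBot ℕ) := by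
  rw [degree_lt_iff] at h ⊢
  intro i hi
  rw [coeff_sub, coeff_monomial]
  split_ifs with hn
  · rw [hn, sub_self]
  · rw [h i (by omega), sub_zero]

/-- Induction on the bound for `deg F`, splitting off the top monomial of `F`. -/
theorem coeff_mul_of_degree_lt {G : SkewPoly σ δ} {m : ℕ} (hG : ∀ i, m < i → G.coeff i = 0)
    (n : ℕ) (F : SkewPoly σ δ) (hF : F.degree < (n : ℕ)) :
    ∀ i, n + m ≤ i → (F * G).coeff i = 0 := by
  induction n generalizing F with
  | zero =>
    have : F = 0 := ext_coeff fun i => degree_lt_iff.1 hF i (Nat.zero_le i)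
    simp [this]
  | succ n ih =>
    intro i hi
    have h1 := ih _ (degree_sub_monomial_lt hF) i (by omega)
    rw [sub_mul, coeff_sub, monomial_mul, coeff_smul, (coeff_mulX_pow G hG n).2 i (by omega),
      mul_zero, sub_zero] at h1
    exact h1

/-- The top coefficient is `F_n σⁿ(G_m)`, which is non-zero because an endomorphism of a division
ring is injective. -/
theorem degree_mul_of_degree {F G : SkewPoly σ δ} {n m : ℕ} (hF : F.degree = n)
    (hG : G.degree = m) : (F * G).degree = (n + m : ℕ) := by
  have hG' : ∀ i, m < i → G.coeff i = 0 := fun i hi =>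
    coeff_eq_zero_of_lt (by rw [hG]; exact_mod_cast hi)
  have hFlt : F.degree < (n + 1 : ℕ) := by rw [hF]; exact_mod_cast n.lt_succ_self
  have hFn : F.coeff n ≠ 0 := by
    rw [← natDegree_of_degree hF]; exact coeff_natDegree_ne_zero (ne_zero_of_degree hF)
  have hGm : G.coeff m ≠ 0 := by
    rw [← natDegree_of_degree hG]; exact coeff_natDegree_ne_zero (ne_zero_of_degree hG)
  refine degree_eq_of_coeff ?_ fun i hi => coeff_mul_of_degree_lt hG' _ F hFlt i (by omega)
  have h1 := coeff_mul_of_degree_lt hG' n _ (degree_sub_monomial_lt hFlt) (n + m) le_rfl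
  rw [sub_mul, coeff_sub, monomial_mul, coeff_smul, (coeff_mulX_pow G hG' n).1, sub_eq_zero] at h1
  rw [h1]
  exact mul_ne_zero hFn (iterate_ne_zero hGm n)

theorem natDegree_mul {F G : SkewPoly σ δ} (hF : F ≠ 0) (hG : G ≠ 0) :
    (F * G).natDegree = F.natDegree + G.natDegree :=
  natDegree_of_degree (degree_mul_of_degree (coe_natDegree hF).symm (coe_natDegree hG).symm)

theorem degree_X_sub_C (a : K) : (X - C a : SkewPoly σ δ).degree = (1 : ℕ) := by
  refine degree_eq_of_coeff ?_ fun i hi => ?_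
  · simp [X, C, coeff_monomial]
  · simp [X, C, coeff_monomial, hi.ne, (zero_lt_one.trans hi).ne]

theorem X_sub_C_ne_zero (a : K) : (X - C a : SkewPoly σ δ) ≠ 0 :=
  ne_zero_of_degree (degree_X_sub_C a)

theorem eq_C_of_degree_lt_one {F : SkewPoly σ δ} (h : F.degree < (1 : ℕ)) :
    F = C (F.coeff 0) := by
  ext i
  rw [C, coeff_monomial]
  split_ifs with hi
  · rw [hi]
  · exact degree_lt_iff.1 h i (by omega)

theorem degree_linProd (s : List K) : (linProd δ s).degree = (s.length : ℕ) := by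
  induction s with
  | nil =>
    refine degree_eq_of_coeff (n := 0) ?_ fun i hi => ?_
    · exact (coeff_monomial (σ := σ) (δ := δ) 0 1 0).trans_ne (by simp)
    · exact (coeff_monomial (σ := σ) (δ := δ) 0 1 i).trans (if_neg hi.ne)
  | cons a s ih => exact degree_mul_of_degree ih (degree_X_sub_C a)

/-- Right Euclidean division. -/
theorem exists_eq_mul_add {P : SkewPoly σ δ} (hP : P ≠ 0) (F : SkewPoly σ δ) :
    ∃ Q R : SkewPoly σ δ, F = Q * P + R ∧ R.degree < P.natDegree := by
  have key : ∀ n : ℕ, ∀ F : SkewPoly σ δ, F.degree < n →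
      ∃ Q R : SkewPoly σ δ, F = Q * P + R ∧ R.degree < P.natDegree := by
    intro n
    induction n with
    | zero => exact fun F hF => ⟨0, F, by simp, hF.trans_le (by exact_mod_cast Nat.zero_le _)⟩
    | succ n ih =>
      intro F hF
      rcases lt_or_ge n P.natDegree with hn | hn
      · exact ⟨0, F, by simp, hF.trans_le (by exact_mod_cast hn)⟩
      obtain ⟨k, rfl⟩ := Nat.exists_eq_add_of_le' hn
      have hk := coeff_mulX_pow P (fun i => coeff_eq_zero_of_natDegree_lt) k
      have hne : σ^[k] (P.coeff P.natDegree) ≠ 0 :=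
        iterate_ne_zero (coeff_natDegree_ne_zero hP) k
      -- The leading coefficient of `c xᵏ P` is `c σᵏ(lc P)`; this `c` makes it cancel the top term
      -- of `F`. Only inverses in `K` are needed, not preimages under `σ`.
      set c := F.coeff (k + P.natDegree) * (σ^[k] (P.coeff P.natDegree))⁻¹ with hc
      obtain ⟨Q, R, hQ, hR⟩ := ih (F - monomial k c * P) (by
        rw [degree_lt_iff] at hF ⊢
        intro i hi
        rw [coeff_sub, monomial_mul, coeff_smul]
        rcases hi.eq_or_lt with rfl | hi
        · rw [hk.1, hc, inv_mul_cancel_right₀ hne, sub_self]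
        · rw [hk.2 i hi, hF i hi, mul_zero, sub_zero])
      exact ⟨Q + monomial k c, R, by rw [add_mul, add_right_comm, ← hQ, sub_add_cancel], hR⟩
  by_cases hF : F = 0
  · refine ⟨0, 0, by simp [hF], WithBot.bot_lt_coe _⟩
  · exact key (F.natDegree + 1) F (by rw [← coe_natDegree hF]; exact_mod_cast Nat.lt_succ_self _)

theorem eq_zero_of_rightDvd_of_degree_lt {P F : SkewPoly σ δ} (h : RightDvd P F)
    (hF : F.degree < P.natDegree) : F = 0 := by
  obtain ⟨Q, rfl⟩ := h
  by_contra hne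
  have hQ : Q ≠ 0 := by rintro rfl; simp at hne
  have hP : P ≠ 0 := by rintro rfl; simp at hne
  rw [← coe_natDegree hne, natDegree_mul hQ hP, Nat.cast_lt] at hF
  omega

end SkewPoly

/-- If `J i` lies in every maximal left ideal above `I i`, then a ring that surjects onto the
product of the `R ⧸ J i` also surjects onto the product of the `R ⧸ I i`. -/
theorem Ideal.surjective_pi_mkQ_of_le_maximal {R ι : Type*} [Ring R] [Fintype ι]
    {I J : ι → Ideal R} (h : ∀ i (M : Ideal R), IsCoatom M → I i ≤ M → J i ≤ M)
    (hJ : Function.Surjective (LinearMap.pi fun i => (J i).mkQ)) :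
    Function.Surjective (LinearMap.pi fun i => (I i).mkQ) := by
  classical
  rw [← LinearMap.range_eq_top]
  by_contra hne
  -- The product is a finitely generated module, so a proper image lies in a maximal submodule `N`.
  obtain ⟨N, hN, hle⟩ := (eq_top_or_exists_le_coatom _).resolve_left hne
  -- The preimage of `N` under `R → R/I_i → ∏ R/I_j` contains `I_i` and is maximal or everything; in
  -- both cases it contains `J_i`.
  have hJN : ∀ i, J i ≤ N.comap ((LinearMap.single R (fun i => R ⧸ I i) i).comp (I i).mkQ) := by
    intro i
    rcases Submodule.isCoatom_comap_or_eq_top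
      ((LinearMap.single R (fun i => R ⧸ I i) i).comp (I i).mkQ) hN with hc | hc
    · refine h i _ hc fun x hx => ?_
      rw [Submodule.mem_comap, LinearMap.comp_apply, Submodule.mkQ_apply,
        (Submodule.Quotient.mk_eq_zero _).2 hx, map_zero]
      exact N.zero_mem
    · rw [hc]; exact le_top
  apply hN.1
  rw [eq_top_iff]
  intro v _
  choose w hw using fun i => (I i).mkQ_surjective (v i)
  -- As `w i - y ∈ J i`, each component of `v` minus the image of `y` lies in `N`; the image of `y`
  -- does too, hence so does `v`.
  obtain ⟨y, hy⟩ := hJ fun i => (J i).mkQ (w i)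
  have hyN := hle ⟨y, rfl⟩
  have hsub : v - LinearMap.pi (fun i => (I i).mkQ) y ∈ N := by
    rw [← Finset.univ_sum_single (v - _)]
    refine N.sum_mem fun i _ => ?_
    have hi : w i - y ∈ J i := by
      rw [← Submodule.Quotient.eq]
      exact (congrFun hy i).symm
    have := hJN i hi
    rw [Submodule.mem_comap, LinearMap.comp_apply, map_sub, hw] at this
    exact this
  simpa using N.add_mem hsub hyN

/-! ### Quotients by principal left ideals and their dimensions -/

namespace SkewPoly

variable {K : Type*} [DivisionRing K] {σ : K →+* K} {δ : SigmaDerivation σ}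

/-- This makes quotients by left ideals vector spaces over `K`, so that dimensions can be counted.
-/
instance instIsScalarTower : IsScalarTower K (SkewPoly σ δ) (SkewPoly σ δ) :=
  ⟨fun a F G => by
    change (a • F) * G = a • (F * G)
    rw [← C_mul, ← C_mul, mul_assoc]⟩

theorem mem_span_singleton_iff {P F : SkewPoly σ δ} : F ∈ Ideal.span {P} ↔ RightDvd P F := by
  rw [Ideal.mem_span_singleton']
  exact exists_congr fun G => eq_comm

/-- The skew polynomials of degree less than `d` represent the classes modulo a skew polynomial
of degree `d`. -/
noncomputable def quotientEquiv {P : SkewPoly σ δ} (hP : P ≠ 0) :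
    Finsupp.supported K K (Set.Iio P.natDegree) ≃ₗ[K] (SkewPoly σ δ ⧸ Ideal.span {P}) := by
  let f : Finsupp.supported K K (Set.Iio P.natDegree) →ₗ[K] SkewPoly σ δ :=
    (Finsupp.supported K K (Set.Iio P.natDegree)).subtype
  have hf : ∀ F : SkewPoly σ δ, F ∈ Set.range f ↔ F.degree < P.natDegree := by
    intro F
    rw [degree_lt_iff]
    constructor
    · rintro ⟨G, rfl⟩ i hi
      by_contra hne
      exact absurd (G.2 (Finsupp.mem_support_iff.2 hne)) (not_lt.2 hi)
    · intro h
      refine ⟨⟨F, fun i hi => ?_⟩, rfl⟩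
      by_contra hlt
      exact Finsupp.mem_support_iff.1 hi (h i (not_lt.1 hlt))
  refine LinearEquiv.ofBijective (((Ideal.span {P}).mkQ.restrictScalars K).comp f) ⟨?_, ?_⟩
  · refine (injective_iff_map_eq_zero _).2 fun G hG => ?_
    have hG' : f G ∈ Ideal.span {P} := (Submodule.Quotient.mk_eq_zero _).1 hG
    exact Subtype.ext (eq_zero_of_rightDvd_of_degree_lt (mem_span_singleton_iff.1 hG')
      ((hf _).1 ⟨G, rfl⟩))
  · intro y
    obtain ⟨F, rfl⟩ := (Ideal.span {P}).mkQ_surjective y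
    obtain ⟨Q, R, hQ, hR⟩ := exists_eq_mul_add hP F
    obtain ⟨G, hG⟩ := (hf R).2 hR
    refine ⟨G, ?_⟩
    change (Ideal.span {P}).mkQ (f G) = _
    rw [hG, ← sub_eq_zero, ← map_sub]
    refine (Submodule.Quotient.mk_eq_zero _).2 (mem_span_singleton_iff.2 ⟨-Q, ?_⟩)
    rw [hQ, neg_mul]
    abel

theorem finite_quotient {P : SkewPoly σ δ} (hP : P ≠ 0) :
    Module.Finite K (SkewPoly σ δ ⧸ Ideal.span {P}) :=
  Module.Finite.equiv ((Finsupp.supportedEquivFinsupp _).symm.trans (quotientEquiv hP))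

theorem finrank_quotient {P : SkewPoly σ δ} (hP : P ≠ 0) :
    Module.finrank K (SkewPoly σ δ ⧸ Ideal.span {P}) = P.natDegree := by
  rw [← ((Finsupp.supportedEquivFinsupp _).symm.trans (quotientEquiv hP)).finrank_eq,
    Module.finrank_finsupp_self, Fintype.card_Iio, Nat.card_Iio]

theorem not_finite : ¬ Module.Finite K (SkewPoly σ δ) := by
  intro h
  have h' : Module.Finite K (ℕ →₀ K) := h
  exact not_finite_iff_infinite.2 inferInstance
    (Module.Finite.finite_basis (Finsupp.basisSingleOne (R := K) (ι := ℕ)))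

/-! ### Simultaneous reduction and least left common multiples -/

variable {ι : Type*}

/-- The simultaneous reduction modulo the left ideals generated by the members of a family. -/
noncomputable def reduction (P : ι → SkewPoly σ δ) :
    SkewPoly σ δ →ₗ[SkewPoly σ δ] (∀ i, SkewPoly σ δ ⧸ Ideal.span {P i}) :=
  LinearMap.pi fun i => (Ideal.span {P i}).mkQ

theorem reduction_eq_zero_iff {P : ι → SkewPoly σ δ} {F : SkewPoly σ δ} :
    reduction P F = 0 ↔ ∀ i, RightDvd (P i) F := by
  simp only [funext_iff, ← mem_span_singleton_iff]
  exact forall_congr' fun i => Submodule.Quotient.mk_eq_zero _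

/-- Modulo their least left common multiple, skew polynomials embed into the product of the
quotients. -/
theorem IsLLCM.exists_injective {P : ι → SkewPoly σ δ} {M : SkewPoly σ δ} (hM : IsLLCM P M) :
    ∃ g : (SkewPoly σ δ ⧸ Ideal.span {M}) →ₗ[K] (∀ i, SkewPoly σ δ ⧸ Ideal.span {P i}),
      Function.Injective g ∧ (Function.Surjective g ↔ Function.Surjective (reduction P)) := by
  have hker : ∀ F, reduction P F = 0 ↔ F ∈ Ideal.span {M} := by
    intro F
    rw [reduction_eq_zero_iff, mem_span_singleton_iff]
    refine ⟨hM.2.2 F, ?_⟩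
    rintro ⟨Q, rfl⟩ i
    obtain ⟨B, hB⟩ := hM.2.1 i
    exact ⟨Q * B, by rw [mul_assoc, ← hB]⟩
  let g : (SkewPoly σ δ ⧸ Ideal.span {M}) →ₗ[K] (∀ i, SkewPoly σ δ ⧸ Ideal.span {P i}) :=
    (Submodule.liftQ (Ideal.span {M}) (reduction P) fun F hF => (hker F).2 hF).restrictScalars K
  refine ⟨g, (injective_iff_map_eq_zero g).2 fun y hy => ?_, fun h v => ?_, fun h v => ?_⟩
  · obtain ⟨F, rfl⟩ := (Ideal.span {M}).mkQ_surjective y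
    exact (Submodule.Quotient.mk_eq_zero _).2 ((hker F).1 hy)
  · obtain ⟨y, rfl⟩ := h v
    obtain ⟨F, rfl⟩ := (Ideal.span {M}).mkQ_surjective y
    exact ⟨F, rfl⟩
  · obtain ⟨F, rfl⟩ := h v
    exact ⟨(Ideal.span {M}).mkQ F, rfl⟩

variable [Fintype ι]

/-- Otherwise the reduction would embed the infinite-dimensional ring into a finite-dimensional
product. -/
theorem isAlgebraicSet_range {P : ι → SkewPoly σ δ} (hP : ∀ i, P i ≠ 0) :
    IsAlgebraicSet (Set.range P) := by
  intro h
  have := fun i => finite_quotient (hP i)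
  refine not_finite (Module.Finite.of_injective ((reduction P).restrictScalars K) ?_)
  rw [← LinearMap.ker_eq_bot, LinearMap.ker_eq_bot']
  intro F hF
  have hF' : F ∈ vanishingIdeal (Set.range P) := by
    rintro _ ⟨i, rfl⟩
    exact reduction_eq_zero_iff.1 hF i
  rw [h] at hF'
  exact hF'

theorem Monic.ne_zero {F : SkewPoly σ δ} (h : F.Monic) : F ≠ 0 := by
  rintro rfl
  exact zero_ne_one (α := K) h

/-- The remainder of a common left multiple modulo `F_Ω` is again a common left multiple, of smaller
degree, so it vanishes by minimality. -/
theorem isLLCM_minimalPoly {P : ι → SkewPoly σ δ} (hP : ∀ i, P i ≠ 0) :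
    IsLLCM P (minimalPoly (Set.range P)) := by
  obtain ⟨hmem, hmonic, hmin⟩ := minimalPoly_spec (isAlgebraicSet_range hP)
  refine ⟨hmonic, fun i => hmem _ ⟨i, rfl⟩, fun G hG => ?_⟩
  obtain ⟨Q, R, hQ, hR⟩ := exists_eq_mul_add hmonic.ne_zero G
  suffices R = 0 from ⟨Q, by rw [hQ, this, add_zero]⟩
  by_contra hR0
  refine not_le.2 hR ?_
  rw [coe_natDegree hmonic.ne_zero]
  refine hmin R ?_ hR0
  rintro _ ⟨i, rfl⟩
  obtain ⟨A, hA⟩ := hG i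
  obtain ⟨B, hB⟩ := hmem _ ⟨i, rfl⟩
  refine ⟨A - Q * B, ?_⟩
  rw [sub_mul, mul_assoc, ← hA, ← hB, hQ, add_sub_cancel_left]

theorem finrank_pi_quotient {P : ι → SkewPoly σ δ} (hP : ∀ i, P i ≠ 0) :
    Module.finrank K (∀ i, SkewPoly σ δ ⧸ Ideal.span {P i}) = ∑ i, (P i).natDegree := by
  have := fun i => finite_quotient (hP i)
  rw [Module.finrank_pi_fintype]
  exact Finset.sum_congr rfl fun i _ => finrank_quotient (hP i)

theorem IsLLCM.natDegree_le {P : ι → SkewPoly σ δ} (hP : ∀ i, P i ≠ 0) {M : SkewPoly σ δ}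
    (hM : IsLLCM P M) : M.natDegree ≤ ∑ i, (P i).natDegree := by
  have := fun i => finite_quotient (hP i)
  obtain ⟨g, hinj, -⟩ := hM.exists_injective
  rw [← finrank_quotient hM.1.ne_zero, ← finrank_pi_quotient hP]
  exact LinearMap.finrank_le_finrank_of_injective hinj

/-- The least left common multiple of a family has the largest possible degree if and only if
simultaneous congruences modulo the family are solvable. -/
theorem IsLLCM.natDegree_eq_iff {P : ι → SkewPoly σ δ} (hP : ∀ i, P i ≠ 0) {M : SkewPoly σ δ}
    (hM : IsLLCM P M) :
    M.natDegree = ∑ i, (P i).natDegree ↔ Function.Surjective (reduction P) := by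
  have := fun i => finite_quotient (hP i)
  have := finite_quotient hM.1.ne_zero
  obtain ⟨g, hinj, hsurj⟩ := hM.exists_injective
  rw [← hsurj, ← finrank_quotient hM.1.ne_zero, ← finrank_pi_quotient hP]
  exact ⟨fun h => (LinearMap.injective_iff_surjective_of_finrank_eq_finrank h).1 hinj,
    fun h => (LinearEquiv.ofBijective g ⟨hinj, h⟩).finrank_eq⟩

/-- P-independence sums degrees over a set; injectivity of `P` turns this into the sum over the
index type. -/
theorem isPIndependent_range_iff {P : ι → SkewPoly σ δ} (hP : ∀ i, P i ≠ 0)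
    (hinj : Function.Injective P) :
    IsPIndependent (Set.range P) ↔ Function.Surjective (reduction P) := by
  classical
  have hL := isLLCM_minimalPoly hP
  rw [← hL.natDegree_eq_iff hP]
  have hsum : ∀ hfin : (Set.range P).Finite,
      ∑ Q ∈ hfin.toFinset, Q.natDegree = ∑ i, (P i).natDegree := by
    intro hfin
    have : hfin.toFinset = Finset.univ.image P := by ext; simp
    rw [this, Finset.sum_image fun i _ j _ h => hinj h]
  constructor
  · rintro ⟨hfin, -, h⟩
    rw [natDegree_of_degree h, hsum]
  · intro h
    refine ⟨Set.finite_range P, isAlgebraicSet_range hP, ?_⟩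
    rw [hsum, ← h, coe_natDegree hL.1.ne_zero]

/-! ### Maximal left ideals above products of linear factors -/

theorem linProd_ne_zero (s : List K) : linProd δ s ≠ 0 := ne_zero_of_degree (degree_linProd s)

theorem C_injective : Function.Injective (C : K → SkewPoly σ δ) :=
  Finsupp.single_injective (M := K) 0

theorem C_zero : (C 0 : SkewPoly σ δ) = 0 := map_zero (monomial 0)

theorem C_mem_iff {J : Ideal (SkewPoly σ δ)} (hJ : J ≠ ⊤) {c : K} : C c ∈ J ↔ c = 0 := by
  refine ⟨fun h => ?_, fun h => ?_⟩
  · by_contra hc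
    refine hJ ((Ideal.eq_top_iff_one J).2 ?_)
    have := J.mul_mem_left (C c⁻¹) h
    rw [C_mul_C, inv_mul_cancel₀ hc] at this
    exact this
  · rw [h, C_zero]
    exact J.zero_mem

theorem exists_eq_mul_X_sub_C_add (a : K) (F : SkewPoly σ δ) :
    ∃ (Q : SkewPoly σ δ) (c : K), F = Q * (X - C a) + C c := by
  obtain ⟨Q, R, hQ, hR⟩ := exists_eq_mul_add (X_sub_C_ne_zero a) F
  rw [natDegree_of_degree (degree_X_sub_C a)] at hR
  exact ⟨Q, R.coeff 0, by rw [← eq_C_of_degree_lt_one hR]; exact hQ⟩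

/-- The remainder of `F` modulo `x - b` is a constant in the proper left ideal `J`, hence zero. In
effect `R(x - b)` is maximal. -/
theorem isZeroOf_of_mem {J : Ideal (SkewPoly σ δ)} (hJ : J ≠ ⊤) {b : K} (hb : X - C b ∈ J)
    {F : SkewPoly σ δ} (hF : F ∈ J) : F.IsZeroOf b := by
  obtain ⟨Q, c, rfl⟩ := exists_eq_mul_X_sub_C_add b F
  have hc := (J.add_mem_iff_right (J.mul_mem_left Q hb)).1 hF
  rw [(C_mem_iff hJ).1 hc, C_zero, add_zero]
  exact ⟨Q, rfl⟩

/-- A maximal left ideal that contains a product of linear factors contains a linear factor. -/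
theorem exists_X_sub_C_mem_of_linProd_mem (s : List K) {J : Ideal (SkewPoly σ δ)}
    (hJ : IsCoatom J) (hs : linProd δ s ∈ J) : ∃ b : K, X - C b ∈ J := by
  induction s generalizing J with
  | nil => exact absurd ((Ideal.eq_top_iff_one J).2 hs) hJ.1
  | cons a s ih =>
    by_cases ha : X - C a ∈ J
    · exact ⟨a, ha⟩
    -- The left ideal `{G | G (x - a) ∈ J}` is maximal or everything and contains the shorter
    -- product, so induction applies in the first case.
    rcases Submodule.isCoatom_comap_or_eq_top
      (LinearMap.toSpanSingleton (SkewPoly σ δ) (SkewPoly σ δ) (X - C a)) hJ with hc | hc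
    · obtain ⟨b, hb⟩ := ih hc hs
      have hb' : (X - C b) * (X - C a) ∈ J := hb
      have htop := hJ.2 _ (lt_of_le_of_ne (le_sup_left (b := Ideal.span {X - C a})) fun h =>
        ha (h ▸ Ideal.mem_sup_right (Ideal.mem_span_singleton_self _)))
      obtain ⟨j, hj, y, hy, h1⟩ := Submodule.mem_sup.1 ((Ideal.eq_top_iff_one _).1 htop)
      obtain ⟨G, rfl⟩ := mem_span_singleton_iff.1 hy
      -- Since `(x - b)(x - a) ∈ J`, the cofactor in `1 = j + G (x - a)` may be replaced by its
      -- constant remainder `c` modulo `x - b`.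
      obtain ⟨Q, c, rfl⟩ := exists_eq_mul_X_sub_C_add b G
      have hmem : C c * (X - C a) - 1 ∈ J := by
        have h2 : C c * (X - C a) - 1 = -(j + Q * ((X - C b) * (X - C a))) := by
          rw [← h1, add_mul, mul_assoc]
          abel
        rw [h2]
        exact J.neg_mem (J.add_mem hj (J.mul_mem_left Q hb'))
      have hc0 : c ≠ 0 := by
        rintro rfl
        refine hJ.1 ((Ideal.eq_top_iff_one J).2 ?_)
        rw [C_zero, zero_mul, zero_sub] at hmem
        exact neg_mem_iff.1 hmem
      -- Multiplying `c (x - a) - 1 ∈ J` on the left by `c⁻¹` gives `x - a - c⁻¹ ∈ J`.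
      refine ⟨a + c⁻¹, ?_⟩
      have h3 := J.mul_mem_left (C c⁻¹) hmem
      rw [mul_sub, ← mul_assoc, C_mul_C, inv_mul_cancel₀ hc0, mul_one] at h3
      have h4 : (C 1 : SkewPoly σ δ) = 1 := rfl
      have h5 : (C (a + c⁻¹) : SkewPoly σ δ) = C a + C c⁻¹ := map_add (monomial 0) _ _
      rwa [h4, one_mul, sub_sub, ← h5] at h3
    · refine absurd ?_ ha
      have : (1 : SkewPoly σ δ) * (X - C a) ∈ J := by
        change (1 : SkewPoly σ δ) ∈ Submodule.comap
          (LinearMap.toSpanSingleton (SkewPoly σ δ) (SkewPoly σ δ) (X - C a)) J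
        rw [hc]
        trivial
      rwa [one_mul] at this

/-! ### Multiplicity sequences and P-independence -/

theorem IsMultSeqFrom.isZeroOf {a : K} {s : List K} (h : IsMultSeqFrom δ a s) :
    IsZeroOf (linProd δ s) a := (h.2 a).2 rfl

/-- `J` contains some `x - b`, so `b` is a zero of `P_𝐚`, and uniqueness of the zero forces `b = a`.
-/
theorem IsMultSeqFrom.X_sub_C_mem {a : K} {s : List K} (h : IsMultSeqFrom δ a s)
    {J : Ideal (SkewPoly σ δ)} (hJ : IsCoatom J) (hs : linProd δ s ∈ J) : X - C a ∈ J := by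
  obtain ⟨b, hb⟩ := exists_X_sub_C_mem_of_linProd_mem s hJ hs
  rwa [← (h.2 b).1 (isZeroOf_of_mem hJ.1 hb hs)]

theorem isPIndependentPoints_range_iff {a : ι → K} (ha : Function.Injective a) :
    IsPIndependentPoints δ (Set.range a) ↔
      Function.Surjective (reduction fun i => (X - C (a i) : SkewPoly σ δ)) := by
  rw [IsPIndependentPoints, ← Set.range_comp]
  exact isPIndependent_range_iff (fun i => X_sub_C_ne_zero (a i)) fun i j h =>
    ha (C_injective (sub_right_injective h))

/-- The degree of the least left common multiple of multiplicity sequences is the sum of their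
lengths if and only if their starting points are P-independent. -/
theorem natDegree_minimalPoly_linProd_eq_iff {a : ι → K} (ha : Function.Injective a)
    {s : ι → List K} (hs : ∀ i, IsMultSeqFrom δ (a i) (s i)) :
    (minimalPoly (Set.range fun i => linProd δ (s i))).natDegree = ∑ i, (s i).length ↔
      IsPIndependentPoints δ (Set.range a) := by
  have h := (isLLCM_minimalPoly fun i => linProd_ne_zero (δ := δ) (s i)).natDegree_eq_iff
    fun i => linProd_ne_zero (s i)
  simp only [fun i => natDegree_of_degree (degree_linProd (δ := δ) (s i))] at h
  rw [h, isPIndependentPoints_range_iff ha]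
  constructor
  -- The easy direction: `P_𝐚` already lies in `R(x - a)`, since `a` is a zero of it.
  · refine Ideal.surjective_pi_mkQ_of_le_maximal fun i M _ hM => le_trans ?_ hM
    rw [Ideal.span_singleton_le_iff_mem, mem_span_singleton_iff]
    exact (hs i).isZeroOf
  · refine Ideal.surjective_pi_mkQ_of_le_maximal fun i M hM hle => ?_
    rw [Ideal.span_singleton_le_iff_mem] at hle ⊢
    exact (hs i).X_sub_C_mem hM hle

theorem degree_le_of_rightDvd {P F : SkewPoly σ δ} (h : RightDvd P F) (hF : F ≠ 0) :
    P.degree ≤ F.degree := by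
  have hP : P ≠ 0 := by
    rintro rfl
    obtain ⟨G, rfl⟩ := h
    exact hF (mul_zero G)
  rw [← coe_natDegree hP]
  exact not_lt.1 fun hlt => hF (eq_zero_of_rightDvd_of_degree_lt h hlt)

/-- Degrees add, so equal degrees force a cofactor of degree `0`. -/
theorem exists_eq_C_mul_iff {M F : SkewPoly σ δ} (h : RightDvd M F) (hF : F ≠ 0) :
    F.degree = M.degree ↔ ∃ c : K, c ≠ 0 ∧ F = C c * M := by
  constructor
  · obtain ⟨Q, rfl⟩ := h
    intro hd
    have hQ : Q ≠ 0 := by rintro rfl; simp at hF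
    have hM : M ≠ 0 := by rintro rfl; simp at hF
    have hn : (Q * M).natDegree = M.natDegree := by rw [natDegree, hd]; rfl
    rw [natDegree_mul hQ hM] at hn
    have hQC : Q = C (Q.coeff 0) := eq_C_of_degree_lt_one (by
      rw [← coe_natDegree hQ]
      exact_mod_cast (by omega : Q.natDegree < 1))
    refine ⟨Q.coeff 0, ?_, by rw [← hQC]⟩
    intro h0
    rw [h0, C_zero] at hQC
    exact hQ hQC
  · rintro ⟨c, hc, rfl⟩
    exact degree_C_mul hc M

theorem degree_minimalPoly_linProd {a : ι → K} (ha : Function.Injective a) {r : ι → ℕ}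
    {s : ι → List K} (hs : ∀ i, IsMultSeqFrom δ (a i) (s i) ∧ (s i).length = r i)
    (hΨ : IsPIndependentPoints δ (Set.range a)) :
    (minimalPoly (Set.range fun i => linProd δ (s i))).degree = ((∑ i, r i : ℕ) : WithBot ℕ) := by
  rw [← coe_natDegree (isLLCM_minimalPoly fun i => linProd_ne_zero (s i)).1.ne_zero,
    (natDegree_minimalPoly_linProd_eq_iff ha fun i => (hs i).1).2 hΨ]
  simp only [fun i => (hs i).2]

end SkewPoly

/-! ### The degree bound and its case of equality -/

theorem mainTheorem4 {K : Type*} [DivisionRing K] (σ : K →+* K) (δ : SigmaDerivation σ)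
    (n : ℕ) (_hn : 0 < n) (a : Fin n → K) (_ha : Function.Injective a)
    (r : Fin n → ℕ) (_hr : ∀ i, 0 < r i) :
    -- P-independence implies the degree bound
    (SkewPoly.IsPIndependentPoints δ (Set.range a) →
      ∀ F : SkewPoly σ δ, F ≠ 0 → (∀ i, F.IsZeroOfMultiplicity (a i) (r i)) →
        ((∑ i, r i : ℕ) : WithBot ℕ) ≤ F.degree) ∧
    -- the degree bound implies P-independence, if multiplicity `r i` at `a i` is possible at all
    ((∀ i, ∃ s : List K, SkewPoly.IsMultSeqFrom δ (a i) s ∧ s.length = r i) →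
      (∀ F : SkewPoly σ δ, F ≠ 0 → (∀ i, F.IsZeroOfMultiplicity (a i) (r i)) →
        ((∑ i, r i : ℕ) : WithBot ℕ) ≤ F.degree) →
      SkewPoly.IsPIndependentPoints δ (Set.range a)) ∧
    -- the case of equality
    (SkewPoly.IsPIndependentPoints δ (Set.range a) →
      ∀ F : SkewPoly σ δ, F ≠ 0 → (∀ i, F.IsZeroOfMultiplicity (a i) (r i)) →
        (F.degree = ((∑ i, r i : ℕ) : WithBot ℕ) ↔
          ∃ s : Fin n → List K,
            (∀ i, SkewPoly.IsMultSeqFrom δ (a i) (s i) ∧ (s i).length = r i) ∧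
            ∃ c : K, c ≠ 0 ∧
              F = SkewPoly.C c *
                SkewPoly.minimalPoly (Set.range fun i => SkewPoly.linProd δ (s i)))) ∧
    -- the case of equality, for prescribed sequences via which `F` has its zeros
    (SkewPoly.IsPIndependentPoints δ (Set.range a) →
      ∀ s : Fin n → List K,
        (∀ i, SkewPoly.IsMultSeqFrom δ (a i) (s i) ∧ (s i).length = r i) →
        ∀ F : SkewPoly σ δ, F ≠ 0 → (∀ i, SkewPoly.RightDvd (SkewPoly.linProd δ (s i)) F) →
          (F.degree = ((∑ i, r i : ℕ) : WithBot ℕ) ↔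
            ∃ c : K, c ≠ 0 ∧
              F = SkewPoly.C c *
                SkewPoly.minimalPoly (Set.range fun i => SkewPoly.linProd δ (s i)))) ∧
    -- the minimal skew polynomials used above are least left common multiples
    (∀ s : Fin n → List K,
      (∀ i, SkewPoly.IsMultSeqFrom δ (a i) (s i) ∧ (s i).length = r i) →
      SkewPoly.IsLLCM (fun i => SkewPoly.linProd δ (s i))
        (SkewPoly.minimalPoly (Set.range fun i => SkewPoly.linProd δ (s i)))) := by
  have hne : ∀ s : Fin n → List K, ∀ i, SkewPoly.linProd δ (s i) ≠ 0 :=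
    fun s i => SkewPoly.linProd_ne_zero (s i)
  have heq : SkewPoly.IsPIndependentPoints δ (Set.range a) →
      ∀ s : Fin n → List K,
        (∀ i, SkewPoly.IsMultSeqFrom δ (a i) (s i) ∧ (s i).length = r i) →
        ∀ F : SkewPoly σ δ, F ≠ 0 → (∀ i, SkewPoly.RightDvd (SkewPoly.linProd δ (s i)) F) →
          (F.degree = ((∑ i, r i : ℕ) : WithBot ℕ) ↔
            ∃ c : K, c ≠ 0 ∧
              F = SkewPoly.C c *
                SkewPoly.minimalPoly (Set.range fun i => SkewPoly.linProd δ (s i))) := by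
    intro hΨ s hs F hF hdvd
    rw [← SkewPoly.degree_minimalPoly_linProd _ha hs hΨ]
    exact SkewPoly.exists_eq_C_mul_iff ((SkewPoly.isLLCM_minimalPoly (hne s)).2.2 F hdvd) hF
  refine ⟨fun hΨ F hF hz => ?_, fun hex hbound => ?_, fun hΨ F hF hz => ⟨fun hd => ?_, ?_⟩, heq,
    fun s _ => SkewPoly.isLLCM_minimalPoly (hne s)⟩
  · choose s hs hlen hdvd using hz
    rw [← SkewPoly.degree_minimalPoly_linProd _ha (fun i => ⟨hs i, hlen i⟩) hΨ]
    exact SkewPoly.degree_le_of_rightDvd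
      ((SkewPoly.isLLCM_minimalPoly (hne s)).2.2 F hdvd) hF
  · choose s hs hlen using hex
    have hL := SkewPoly.isLLCM_minimalPoly (hne s)
    -- The bound is tested on `F_Ω` itself; with the dimension bound from above, its degree is
    -- exactly `∑ r_i`.
    have hlow := hbound _ hL.1.ne_zero fun i => ⟨s i, hs i, hlen i, hL.2.1 i⟩
    rw [← SkewPoly.coe_natDegree hL.1.ne_zero, Nat.cast_le] at hlow
    have hup := hL.natDegree_le (hne s)
    simp only [fun i => SkewPoly.natDegree_of_degree (SkewPoly.degree_linProd (δ := δ) (s i)),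
      hlen] at hup
    refine (SkewPoly.natDegree_minimalPoly_linProd_eq_iff _ha hs).1 ?_
    simp only [hlen]
    exact le_antisymm hup hlow
  · choose s hs hlen hdvd using hz
    exact ⟨s, fun i => ⟨hs i, hlen i⟩, (heq hΨ s (fun i => ⟨hs i, hlen i⟩) F hF hdvd).1 hd⟩
  · rintro ⟨s, hs, c, hc, rfl⟩
    rw [SkewPoly.degree_C_mul hc, SkewPoly.degree_minimalPoly_linProd _ha hs hΨ]
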